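/- Definitions. A labeled transition system (LTS) over a set $AP$ of atoms consists of a set of states, a set of initial states, a set of actions, a set of transitions (triples state, action, state), and a labeling of every state by a finite subset of $AP$. Let $\mathrm{CTL}^*\backslash\mathsf{X}$ be the logic $\mathrm{CTL}^*$ without the next-time operator: its state formulas are built from $\top$ and atoms by Boolean connectives and the path quantifiers $\mathsf{E}\psi$, $\mathsf{A}\psi$, and its path formulas $\psi$ are built from state formulas by Boolean connectives and $\mathsf{U}$ (until). It is interpreted over LTSs in the usual way, with path quantifiers ranging over infinite paths. An LTS $M$ satisfies a state formula $\varphi$, written $M\models\varphi$, if all its initial states satisfy it. For $d\in\mathbb{N}$, let $d\text{-}\mathrm{CTL}^*\backslash\mathsf{X}$ be the set of state formulas whose nesting depth of path quantifiers is at most $d$. LTSs $M,N$ over the same atoms are $d\text{-}\mathrm{CTL}^*\backslash\mathsf{X}$-equivalent if $M\models\varphi\iff N\models\varphi$ for every $\varphi\in d\text{-}\mathrm{CTL}^*\backslash\mathsf{X}$. A topology $G=(V,E,x)$ is a finite directed graph on $V=\{1,\dots,n\}$, $n\ge 1$, without self-loops, with an initial vertex $x\in V$. For a $k$-tuple $\bar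 g=(g_1,\dots,g_k)$ of distinct vertices of $G$, the graph LTS $G|\bar g$ is the LTS over the atoms $\{1,\dots,k\}$ with state set $V$, only initial state $x$, a single action, one transition $v\to w$ for each edge $(v,w)\in E$, and the label of $v$ equal to $\{i\}$ if $v=g_i$ and to $\emptyset$ if $v$ is not in $\bar g$. Theorem (Finiteness). For all positive integers $k$ and $d$, there are only finitely many $d\text{-}\mathrm{CTL}^*\backslash\mathsf{X}$-equivalence classes of graph LTSs $G|\bar g$, where $G$ ranges over all topologies and $\bar g$ over all $k$-tuples of distinct vertices of $G$. -/

import Mathlib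

namespace TokenPassing

/-- A labeled transition system over a set `AP` of atomic propositions. Every state is labeled by a
finite set of atoms. -/
structure LTS (AP : Type) where
  State : Type
  Act : Type
  init : Set State
  trans : Set (State × Act × State)
  label : State → Finset AP

mutual
/-- State formulas of CTL* without the next operator. `ex ψ` is the formula `E ψ`; the dual path
quantifier is the abbreviation `A ψ := ¬ E ¬ ψ`, and the other Boolean and temporal operators are
the usual abbreviations too. -/
inductive StateFormula (AP : Type) : Type
  | tt : StateFormula AP
  | atom : AP → StateFormula AP
  | neg : StateFormula AP → StateFormula AP
  | and : StateFormula AP → StateFormula AP → StateFormula AP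
  | ex : PathFormula AP → StateFormula AP

/-- Path formulas of CTL* without the next operator. -/
inductive PathFormula (AP : Type) : Type
  | state : StateFormula AP → PathFormula AP
  | neg : PathFormula AP → PathFormula AP
  | and : PathFormula AP → PathFormula AP → PathFormula AP
  | until : PathFormula AP → PathFormula AP → PathFormula AP
end

mutual
/-- Nesting depth of path quantifiers of a state formula. -/
def StateFormula.depth {AP : Type} : StateFormula AP → ℕ
  | .tt => 0
  | .atom _ => 0
  | .neg φ => φ.depth
  | .and φ φ' => max φ.depth φ'.depth
  | .ex ψ => ψ.depth + 1

/-- Nesting depth of path quantifiers of a path formula. -/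
def PathFormula.depth {AP : Type} : PathFormula AP → ℕ
  | .state φ => φ.depth
  | .neg ψ => ψ.depth
  | .and ψ ψ' => max ψ.depth ψ'.depth
  | .until ψ ψ' => max ψ.depth ψ'.depth
end

/-- The infinite paths of an LTS: state projections of infinite state-action paths. -/
def LTS.IsPath {AP : Type} (M : LTS AP) (π : ℕ → M.State) : Prop :=
  ∀ i, ∃ σ : M.Act, (π i, σ, π (i + 1)) ∈ M.trans

mutual
/-- Satisfaction of a state formula at a state; path quantifiers range over infinite paths. -/
def StateFormula.Sat {AP : Type} (M : LTS AP) : StateFormula AP → M.State → Prop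
  | .tt, _ => True
  | .atom p, q => p ∈ M.label q
  | .neg φ, q => ¬ φ.Sat M q
  | .and φ φ', q => φ.Sat M q ∧ φ'.Sat M q
  | .ex ψ, q => ∃ π : ℕ → M.State, M.IsPath π ∧ π 0 = q ∧ ψ.Sat M π

/-- Satisfaction of a path formula along an infinite sequence of states. -/
def PathFormula.Sat {AP : Type} (M : LTS AP) : PathFormula AP → (ℕ → M.State) → Prop
  | .state φ, π => φ.Sat M (π 0)
  | .neg ψ, π => ¬ ψ.Sat M π
  | .and ψ ψ', π => ψ.Sat M π ∧ ψ'.Sat M π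
  | .until ψ ψ', π => ∃ j, ψ'.Sat M (fun n => π (j + n)) ∧
      ∀ i < j, ψ.Sat M (fun n => π (i + n))
end

/-- An LTS models a formula if all its initial states satisfy it. -/
def LTS.Models {AP : Type} (M : LTS AP) (φ : StateFormula AP) : Prop :=
  ∀ q ∈ M.init, φ.Sat M q

/-- `M` and `N` agree on all CTL*∖X formulas of path-quantifier nesting depth at most `d`. -/
def LTS.Equivalent {AP : Type} (d : ℕ) (M N : LTS AP) : Prop :=
  ∀ φ : StateFormula AP, φ.depth ≤ d → (M.Models φ ↔ N.Models φ)

/-- The `d`-CTL*∖X equivalence class of an LTS. -/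
def LTS.equivClass {AP : Type} (d : ℕ) (M : LTS AP) : Set (LTS AP) :=
  {N | M.Equivalent d N}

/-- A topology: a finite directed graph without self-loops on the vertices `Fin n`, with an initial
vertex (so that `n` is positive). -/
structure Topology where
  n : ℕ
  edge : Set (Fin n × Fin n)
  init : Fin n
  irrefl : ∀ v, (v, v) ∉ edge

/-- The graph LTS of a topology `G` and a tuple `g` of `k` distinct vertices, over the atoms
`Fin k`: the vertex `g i` is labeled `{i}`, and the vertices outside the tuple are labeled `∅`. -/
def Topology.graphLTS {k : ℕ} (G : Topology) (g : Fin k ↪ Fin G.n) : LTS (Fin k) where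
  State := Fin G.n
  Act := Unit
  init := {G.init}
  trans := {t | (t.1, t.2.2) ∈ G.edge}
  label := fun v => Finset.univ.filter fun i => g i = v

end TokenPassing

-- Stuttering of infinite words

namespace TokenPassing

-- Color the vertices of all marked topologies at once, by induction on `d`, with finitely many
-- colors that decide every formula of depth at most `d`. Depth 0 uses the label; the next color
-- adds the set `words` of stutter classes of color words of infinite walks (`Determines.succ`).
-- This suffices because formulas without next cannot see stuttering
-- (`Determines.exists_word_predicate`).
--
-- The point is that `words` takes finitely many values. Along an edge that keeps the color, `words`
-- can only shrink, so the induction also carries a rank on colors that drops at each color change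
-- between unlabeled vertices (`exists_isRank_words`). Between visits to labeled vertices, a walk
-- thus shows boundedly many colors up to stuttering. Each graph has only `k` labeled vertices, so a
-- `profile` with finitely many possible values describes all these excursions, and it determines
-- `words` (`words_subset_of_profile_eq`).

/-- Monotone surjections of `ℕ`, described by unit steps. -/
structure IsInflation (f : ℕ → ℕ) : Prop where
  zero : f 0 = 0
  step : ∀ n, f (n + 1) = f n ∨ f (n + 1) = f n + 1
  surj : ∀ j, ∃ n, f n = j

namespace IsInflation

variable {f : ℕ → ℕ}

theorem monotone (hf : IsInflation f) : Monotone f :=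
  monotone_nat_of_le_succ fun n => by rcases hf.step n with h | h <;> omega

theorem pred : IsInflation Nat.pred where
  zero := rfl
  step := fun n => by cases n <;> simp
  surj := fun j => ⟨j + 1, rfl⟩

theorem shift (hf : IsInflation f) (j : ℕ) : IsInflation fun n => f (j + n) - f j where
  zero := by simp
  step := fun n => by
    have h1 := hf.monotone (Nat.le_add_right j n)
    have h2 := hf.step (j + n)
    rw [← add_assoc]
    omega
  surj := fun i => by
    obtain ⟨n, hn⟩ := hf.surj (f j + i)
    rcases le_total j n with h | h
    · exact ⟨n - j, by simp only [Nat.add_sub_cancel' h]; omega⟩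
    · have := hf.monotone h
      exact ⟨0, by simp only [add_zero]; omega⟩

end IsInflation

/-- One word is obtained from another by repeating letters. -/
def Inflates {C : Type} (w w' : ℕ → C) : Prop :=
  ∃ f, IsInflation f ∧ ∀ n, w' n = w (f n)

/-- Infinite words up to stuttering. -/
abbrev StutterWord (C : Type) : Type := Quot (Inflates (C := C))

-- Walks, segments and chains in a colored graph

section Graph

variable {V C I : Type}

/-- `Segment E c x m u w`: there is a walk of length `m + 1` from `u` to `w` all of whose vertices
but the last one have color `x`. -/
inductive Segment (E : V → V → Prop) (c : V → C) (x : C) : ℕ → V → V → Prop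
  | single {u w : V} : c u = x → E u w → Segment E c x 0 u w
  | cons {m : ℕ} {u v w : V} : c u = x → E u v → Segment E c x m v w →
      Segment E c x (m + 1) u w

theorem Segment.color {E : V → V → Prop} {c : V → C} {x : C} {m : ℕ} {u w : V}
    (h : Segment E c x m u w) : c u = x := by
  cases h <;> assumption

/-- Infinite concatenation of segments. -/
theorem Segment.exists_path {E : V → V → Prop} {c : V → C} {u : ℕ → V} {z : ℕ → C} {m : ℕ → ℕ}
    (h : ∀ j, Segment E c (z j) (m j) (u j) (u (j + 1))) :
    ∃ ρ : ℕ → V, ρ 0 = u 0 ∧ (∀ n, E (ρ n) (ρ (n + 1))) ∧ Inflates z (fun n => c (ρ n)) := by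
  let S := {s : ℕ × V × ℕ // Segment E c (z s.1) s.2.2 s.2.1 (u (s.1 + 1))}
  have hnext : ∀ s : S, ∃ s' : S, E s.1.2.1 s'.1.2.1 ∧
      ((s'.1.1 = s.1.1 ∧ s'.1.2.2 < s.1.2.2) ∨ s'.1.1 = s.1.1 + 1) := by
    rintro ⟨⟨j, v, n⟩, hs⟩
    cases hs with
    | single hc he => exact ⟨⟨(j + 1, u (j + 1), m (j + 1)), h (j + 1)⟩, he, Or.inr rfl⟩
    | @cons m _ v' _ hc he hs => exact ⟨⟨(j, v', m), hs⟩, he, Or.inl ⟨rfl, Nat.lt_succ_self _⟩⟩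
  choose next hE hj using hnext
  let s : ℕ → S := fun n => next^[n] ⟨(0, u 0, m 0), h 0⟩
  have hs : ∀ n, s (n + 1) = next (s n) := fun n => Function.iterate_succ_apply' _ _ _
  refine ⟨fun n => (s n).1.2.1, rfl, fun n => ?_, fun n => (s n).1.1, ⟨rfl, fun n => ?_, ?_⟩,
    fun n => (s n).2.color⟩
  · simp only [hs]
    exact hE _
  · simp only [hs]
    exact (hj (s n)).imp And.left id
  -- Each segment ends after finitely many steps: induction on a bound for its remaining length.
  · have key : ∀ b n, (s n).1.2.2 ≤ b → ∃ n', (s n').1.1 = (s n).1.1 + 1 := by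
      intro b
      induction b with
      | zero =>
        intro n hn
        refine ⟨n + 1, ?_⟩
        rw [hs]
        rcases hj (s n) with h | h
        · omega
        · exact h
      | succ b ih =>
        intro n hn
        rcases hj (s n) with h | h
        · rw [← hs] at h
          obtain ⟨n', hn'⟩ := ih (n + 1) (by omega)
          exact ⟨n', by rw [hn', h.1]⟩
        · exact ⟨n + 1, by rw [hs, h]⟩
    intro j
    induction j with
    | zero => exact ⟨0, rfl⟩
    | succ j ih =>
      obtain ⟨n, hn⟩ := ih
      obtain ⟨n', hn'⟩ := key _ n le_rfl
      exact ⟨n', by rw [hn', hn]⟩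

/-- There is an infinite walk from `u` of constant color. -/
def Diverges (E : V → V → Prop) (c : V → C) (u : V) : Prop :=
  ∃ ρ : ℕ → V, ρ 0 = u ∧ (∀ n, E (ρ n) (ρ (n + 1))) ∧ ∀ n, c (ρ n) = c u

theorem Diverges.exists_edge {E : V → V → Prop} {c : V → C} {u : V} (h : Diverges E c u) :
    ∃ w, E u w ∧ c w = c u ∧ Diverges E c w := by
  obtain ⟨ρ, h0, hE, hc⟩ := h
  refine ⟨ρ 1, h0 ▸ hE 0, hc 1, fun n => ρ (n + 1), rfl, fun n => hE _, fun n => ?_⟩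
  rw [hc, hc]

theorem Diverges.of_edge {E : V → V → Prop} {c : V → C} {u w : V} (h : Diverges E c w)
    (he : E u w) (hc : c w = c u) : Diverges E c u := by
  obtain ⟨ρ, h0, hE, hρ⟩ := h
  refine ⟨fun n => Nat.casesOn n u ρ, rfl, fun n => ?_, fun n => ?_⟩
  · cases n with
    | zero => simpa [h0] using he
    | succ n => exact hE n
  · cases n with
    | zero => rfl
    | succ n => exact (hρ n).trans hc

/-- `Chain E lab c u l e`: from the unlabeled vertex `u` there is a walk through unlabeled vertices
whose sequence of colors without repetitions is `l`, and which then enters a vertex labeled `i` if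
`e = some i`, or keeps its last color forever if `e = none`. -/
inductive Chain (E : V → V → Prop) (lab : V → Option I) (c : V → C) :
    V → List C → Option I → Prop
  | exit {u w : V} {i : I} : lab u = none → E u w → lab w = some i → Chain E lab c u [c u] (some i)
  | diverge {u : V} : lab u = none → Diverges E c u → Chain E lab c u [c u] none
  | stay {u w : V} {l : List C} {e : Option I} : lab u = none → E u w → c w = c u →
      Chain E lab c w l e → Chain E lab c u l e
  | step {u w : V} {l : List C} {e : Option I} : lab u = none → E u w → c w ≠ c u →
      Chain E lab c w l e → Chain E lab c u (c u :: l) e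

variable {E : V → V → Prop} {lab : V → Option I} {c : V → C}

theorem Chain.lab_eq_none {u : V} {l : List C} {e : Option I} (h : Chain E lab c u l e) :
    lab u = none := by
  cases h <;> assumption

theorem Chain.ne_nil {u : V} {l : List C} {e : Option I} (h : Chain E lab c u l e) : l ≠ [] := by
  induction h with
  | stay _ _ _ _ ih => exact ih
  | _ => simp

theorem Chain.exists_segment {u : V} {l : List C} {e : Option I} (h : Chain E lab c u l e) :
    (l = [c u] ∧ e = none ∧ Diverges E c u) ∨
    (∃ i w m, l = [c u] ∧ e = some i ∧ lab w = some i ∧ Segment E c (c u) m u w) ∨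
    ∃ l' w m, l = c u :: l' ∧ l' ≠ [] ∧ Segment E c (c u) m u w ∧ Chain E lab c w l' e := by
  induction h with
  | exit h he hw => exact Or.inr (Or.inl ⟨_, _, 0, rfl, rfl, hw, .single rfl he⟩)
  | diverge h hd => exact Or.inl ⟨rfl, rfl, hd⟩
  | step h he hc hw ih =>
    exact Or.inr (Or.inr ⟨_, _, 0, rfl, hw.ne_nil, .single rfl he, hw⟩)
  | stay h he hc hw ih =>
    rw [hc] at ih
    rcases ih with ⟨h1, h2, h3⟩ | ⟨i, w, m, h1, h2, h3, h4⟩ | ⟨l', w, m, h1, h2, h3, h4⟩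
    · exact Or.inl ⟨h1, h2, h3.of_edge he hc⟩
    · exact Or.inr (Or.inl ⟨i, w, m + 1, h1, h2, h3, .cons rfl he h4⟩)
    · exact Or.inr (Or.inr ⟨l', w, m + 1, h1, h2, .cons rfl he h3, h4⟩)

/-- Applied with `F` a walk, this turns chains of positions in `ℕ` into chains of vertices. -/
theorem Chain.map {V' : Type} {E' : V' → V' → Prop} {lab' : V' → Option I} {c' : V' → C}
    (F : V' → V) (hE : ∀ u w, E' u w → E (F u) (F w)) (hlab : ∀ u, lab (F u) = lab' u)
    (hc : ∀ u, c (F u) = c' u) {u : V'} {l : List C} {e : Option I}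
    (h : Chain E' lab' c' u l e) : Chain E lab c (F u) l e := by
  induction h with
  | exit h he hw =>
    rw [← hc]
    exact .exit ((hlab _).trans h) (hE _ _ he) ((hlab _).trans hw)
  | diverge h hd =>
    rw [← hc]
    obtain ⟨ρ, h0, hρ, hd⟩ := hd
    exact .diverge ((hlab _).trans h)
      ⟨fun n => F (ρ n), by simp only [h0], fun n => hE _ _ (hρ n), fun n => by simp only [hc, hd]⟩
  | stay h he hcw _ ih =>
    exact .stay ((hlab _).trans h) (hE _ _ he) (by simp only [hc, hcw]) ih
  | step h he hcw _ ih =>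
    rw [← hc]
    exact .step ((hlab _).trans h) (hE _ _ he) (by simpa only [hc] using hcw) ih

/-- Along an edge between unlabeled vertices, the color stays or its rank drops. -/
def IsRank (E : V → V → Prop) (lab : V → Option I) (c : V → C) (r : C → ℕ) : Prop :=
  ∀ u w, lab u = none → lab w = none → E u w → c w = c u ∨ r (c w) < r (c u)

theorem Chain.length_le {r : C → ℕ} (hr : IsRank E lab c r) {u : V} {l : List C} {e : Option I}
    (h : Chain E lab c u l e) : l.length ≤ r (c u) + 1 := by
  induction h with
  | exit => simp
  | diverge => simp
  | stay h he hc hw ih => rwa [hc] at ih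
  | step h he hc hw ih =>
    have := (hr _ _ h hw.lab_eq_none he).resolve_left hc
    simp only [List.length_cons]
    omega

/-- Strong induction on the rank of the current color. Either the color never changes again, or its
first change reaches a labeled vertex or a color of smaller rank. -/
theorem exists_chain_of_path {π : ℕ → V} {r : C → ℕ} (hr : IsRank E lab c r)
    (hlab : ∀ u w, c u = c w → lab u = lab w) (hπ : ∀ n, E (π n) (π (n + 1))) (n : ℕ)
    (hn : lab (π n) = none) :
    ∃ l e, Chain (fun a b => b = a + 1) (fun a => lab (π a)) (fun a => c (π a)) n l e := by
  induction hb : r (c (π n)) using Nat.strong_induction_on generalizing n with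
  | _ b ih =>
  subst hb
  by_cases hconst : ∀ m, c (π (n + m)) = c (π n)
  · exact ⟨_, _, .diverge hn ⟨fun m => n + m, rfl, fun m => rfl, hconst⟩⟩
  · push Not at hconst
    obtain ⟨m, hm, hmin⟩ : ∃ m, c (π (n + m)) ≠ c (π n) ∧
        ∀ j < m, c (π (n + j)) = c (π n) := by
      classical
      exact ⟨Nat.find hconst, Nat.find_spec hconst, fun j hj => not_not.1 (Nat.find_min hconst hj)⟩
    obtain ⟨m, rfl⟩ : ∃ m', m = m' + 1 :=
      ⟨m - 1, by rcases m with _ | m; · exact absurd rfl hm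
                 · rfl⟩
    have hnone : ∀ j ≤ m, lab (π (n + j)) = none := fun j hj =>
      (hlab _ _ (hmin j (by omega))).trans hn
    have hlast : ∃ l e, Chain (fun a b => b = a + 1) (fun a => lab (π a)) (fun a => c (π a))
        (n + m) l e := by
      cases hl : lab (π (n + (m + 1))) with
      | some i => exact ⟨_, _, .exit (hnone m le_rfl) rfl hl⟩
      | none =>
        have hc : c (π (n + (m + 1))) ≠ c (π (n + m)) := by rwa [hmin m (by omega)]
        have hlt := (hr _ _ (hnone m le_rfl) hl (hπ (n + m))).resolve_left hc
        have hlt' : r (c (π (n + (m + 1)))) < r (c (π n)) := by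
          rw [← hmin m (by omega)]
          exact hlt
        obtain ⟨l, e, h⟩ := ih _ hlt' _ hl rfl
        exact ⟨_, _, .step (hnone m le_rfl) rfl hc h⟩
    -- Go back from the last position of the constant block to its start, using `stay` at each step.
    have hback : ∀ j ≤ m, ∃ l e, Chain (fun a b => b = a + 1) (fun a => lab (π a))
        (fun a => c (π a)) (n + (m - j)) l e := by
      intro j
      induction j with
      | zero => exact fun _ => hlast
      | succ j ihj =>
        intro hj
        obtain ⟨l, e, h⟩ := ihj (by omega)
        refine ⟨l, e, .stay (hnone _ (by omega)) (by omega) ?_ h⟩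
        rw [hmin _ (by omega), hmin _ (by omega)]
    simpa using hback m le_rfl

-- Finiteness of the word sets

/-- The stutter classes of the color words of the infinite walks from `u`. -/
def words (E : V → V → Prop) (c : V → C) (u : V) : Set (StutterWord C) :=
  {q | ∃ π : ℕ → V, π 0 = u ∧ (∀ n, E (π n) (π (n + 1))) ∧ q = Quot.mk _ fun n => c (π n)}

/-- Prepending `u` to a walk from `w` only repeats the first letter. This monotonicity is what
produces the rank of the next coloring. -/
theorem words_subset_of_edge {u w : V} (he : E u w) (hc : c w = c u) :
    words E c w ⊆ words E c u := by
  rintro _ ⟨π, rfl, hπ, rfl⟩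
  refine ⟨fun n => Nat.casesOn n u π, rfl, fun n => ?_, Quot.sound ⟨_, IsInflation.pred, fun n => ?_⟩⟩
  · cases n with
    | zero => exact he
    | succ n => exact hπ n
  · cases n with
    | zero => exact hc.symm
    | succ n => rfl

/-- `g u i` is the only vertex labeled `i` in the connected component of `u`. -/
structure IsMarking (E : V → V → Prop) (lab : V → Option I) (g : V → I → V) : Prop where
  edge : ∀ u w, E u w → g w = g u
  eq : ∀ u i, lab u = some i → u = g u i
  lab : ∀ u i, lab (g u i) = some i

/-- The chains available after leaving `u` into an unlabeled vertex. -/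
def exitChains (E : V → V → Prop) (lab : V → Option I) (c : V → C) (u : V) :
    Set (List C × Option I) :=
  {p | ∃ w, E u w ∧ Chain E lab c w p.1 p.2}

/-- The part of the surroundings of `u` which determines `words E c u`. -/
def profile (E : V → V → Prop) (lab : V → Option I) (c : V → C) (g : V → I → V) (u : V) :
    Option I × Set (List C × Option I) × (I → C) × Set (I × I) × (I → Set (List C × Option I)) :=
  (lab u, {p | Chain E lab c u p.1 p.2}, fun i => c (g u i), {p | E (g u p.1) (g u p.2)},
    fun i => exitChains E lab c (g u i))

/-- The position `n` of the walk `π` and the vertex `v` have a common future. -/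
inductive Match (E : V → V → Prop) (lab : V → Option I) (c : V → C) (π : ℕ → V) (n : ℕ) (v : V) :
    Prop
  | label (i : I) : lab (π n) = some i → lab v = some i → Match E lab c π n v
  | chain (l : List C) (e : Option I) :
      Chain (fun a b => b = a + 1) (fun a => lab (π a)) (fun a => c (π a)) n l e →
      Chain E lab c v l e → Match E lab c π n v
  | diverge : c (π n) = c v → Diverges (fun a b => b = a + 1) (fun a => c (π a)) n →
      Diverges E c v → Match E lab c π n v

theorem Segment.marking {g : V → I → V} (hg : IsMarking E lab g) {x : C} {m : ℕ} {u w : V}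
    (h : Segment E c x m u w) : g w = g u := by
  induction h with
  | single _ he => exact hg.edge _ _ he
  | cons _ he _ ih => exact ih.trans (hg.edge _ _ he)

/-- One simulation step: both sides advance by nonempty segments of the same color and match again.
At a labeled vertex the profile supplies either an edge to the next labeled vertex or an equal exit
chain; along a chain, both sides leave the first color block. -/
theorem Match.exists_segment {g : V → I → V} (hg : IsMarking E lab g) {r : C → ℕ}
    (hr : IsRank E lab c r) (hlab : ∀ u w, c u = c w → lab u = lab w) {π : ℕ → V}
    (hπ : ∀ n, E (π n) (π (n + 1))) {v₀ : V}
    (hp : profile E lab c g (π 0) = profile E lab c g v₀) {n : ℕ} {v : V} (hv : g v = g v₀)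
    (h : Match E lab c π n v) :
    ∃ x n' v' a b, Segment (fun a b => b = a + 1) (fun a => c (π a)) x a n n' ∧
      Segment E c x b v v' ∧ Match E lab c π n' v' := by
  have hgπ : ∀ n, g (π n) = g (π 0) := fun n => by
    induction n with
    | zero => rfl
    | succ n ih => exact (hg.edge _ _ (hπ n)).trans ih
  simp only [profile, Prod.mk.injEq] at hp
  obtain ⟨-, -, hp1, hp2, hp3⟩ := hp
  cases h with
  | label i h1 h2 =>
    have e1 : π n = g (π 0) i := by rw [← hgπ n]; exact hg.eq _ _ h1
    have e2 : v = g v₀ i := by rw [← hv]; exact hg.eq _ _ h2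
    have hc : c v = c (π n) := by rw [e1, e2]; exact (congrFun hp1 i).symm
    cases hl : lab (π (n + 1)) with
    | some j =>
      have e3 : π (n + 1) = g (π 0) j := by rw [← hgπ (n + 1)]; exact hg.eq _ _ hl
      have he : E (g v₀ i) (g v₀ j) := by
        have : (i, j) ∈ {p : I × I | E (g (π 0) p.1) (g (π 0) p.2)} := by
          have := hπ n
          rwa [e1, e3] at this
        rwa [hp2] at this
      exact ⟨_, n + 1, g v₀ j, 0, 0, .single rfl rfl, .single hc (e2 ▸ he),
        .label j hl (hg.lab _ _)⟩
    | none =>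
      obtain ⟨l, e, hch⟩ := exists_chain_of_path hr hlab hπ (n + 1) hl
      have hmem : (l, e) ∈ exitChains E lab c (g (π 0) i) :=
        ⟨π (n + 1), e1 ▸ hπ n, hch.map π (fun a b hab => hab ▸ hπ a) (fun _ => rfl) fun _ => rfl⟩
      rw [congrFun hp3 i] at hmem
      obtain ⟨w, hw, hchw⟩ := hmem
      exact ⟨_, n + 1, w, 0, 0, .single rfl rfl, .single hc (e2 ▸ hw), .chain l e hch hchw⟩
  | chain l e h1 h2 =>
    rcases h1.exists_segment with ⟨rfl, rfl, a3⟩ | ⟨i, w, m, rfl, rfl, a3, a4⟩ |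
        ⟨l', w, m, rfl, a2, a3, a4⟩ <;>
      rcases h2.exists_segment with ⟨b1, b2, b3⟩ | ⟨j, w', m', b1, b2, b3, b4⟩ |
        ⟨l'', w', m', b1, b2, b3, b4⟩ <;> rw [List.cons.injEq] at b1 <;> obtain ⟨b0, b1⟩ := b1
    · obtain ⟨w, rfl, hcw, hdw⟩ := a3.exists_edge
      obtain ⟨w', hw', hcw', hdw'⟩ := b3.exists_edge
      exact ⟨_, _, _, 0, 0, .single rfl rfl, .single b0.symm hw',
        .diverge (hcw.trans (b0.trans hcw'.symm)) hdw hdw'⟩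
    · cases b2
    · exact absurd b1.symm b2
    · cases b2
    · cases b2
      exact ⟨_, _, _, _, _, a4, b0 ▸ b4, .label _ a3 b3⟩
    · exact absurd b1.symm b2
    · exact absurd b1 a2
    · exact absurd b1 a2
    · subst b1
      exact ⟨_, _, _, _, _, a3, b0 ▸ b3, .chain _ _ a4 b4⟩
  | diverge hc h1 h2 =>
    obtain ⟨w, rfl, hcw, hdw⟩ := h1.exists_edge
    obtain ⟨w', hw', hcw', hdw'⟩ := h2.exists_edge
    exact ⟨_, _, _, 0, 0, .single rfl rfl, .single hc.symm hw',
      .diverge (hcw.trans (hc.trans hcw'.symm)) hdw hdw'⟩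

/-- Iterating the simulation step builds a walk from `v` in pace with the given one. The two color
words need not inflate each other, but both inflate the word with one letter per segment. -/
theorem words_subset_of_profile_eq {g : V → I → V} (hg : IsMarking E lab g) {r : C → ℕ}
    (hr : IsRank E lab c r) (hlab : ∀ u w, c u = c w → lab u = lab w) {u v : V}
    (hp : profile E lab c g u = profile E lab c g v) : words E c u ⊆ words E c v := by
  rintro _ ⟨π, rfl, hπ, rfl⟩
  have h0 : Match E lab c π 0 v := by
    have hp1 : lab (π 0) = lab v := congrArg Prod.fst hp
    have hp2 := congrArg (fun p => p.2.1) hp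
    cases hl : lab (π 0) with
    | some i => exact .label i hl (hp1 ▸ hl)
    | none =>
      obtain ⟨l, e, hch⟩ := exists_chain_of_path hr hlab hπ 0 hl
      have hmem : (l, e) ∈ {p : List C × Option I | Chain E lab c (π 0) p.1 p.2} :=
        hch.map π (fun a b hab => hab ▸ hπ a) (fun _ => rfl) fun _ => rfl
      have hmem' : (l, e) ∈ {p : List C × Option I | Chain E lab c v p.1 p.2} := hp2.subset hmem
      exact .chain l e hch hmem'
  let S := {s : ℕ × V // g s.2 = g v ∧ Match E lab c π s.1 s.2}
  have hnext : ∀ s : S, ∃ (s' : S) (x : C) (a b : ℕ),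
      Segment (fun a b => b = a + 1) (fun a => c (π a)) x a s.1.1 s'.1.1 ∧
      Segment E c x b s.1.2 s'.1.2 := by
    rintro ⟨⟨n, w⟩, hw, hm⟩
    obtain ⟨x, n', w', a, b, ha, hb, hm'⟩ := hm.exists_segment hg hr hlab hπ hp hw
    exact ⟨⟨(n', w'), (hb.marking hg).trans hw, hm'⟩, x, a, b, ha, hb⟩
  choose next x a b ha hb using hnext
  let s : ℕ → S := fun n => next^[n] ⟨(0, v), rfl, h0⟩
  have hs : ∀ n, s (n + 1) = next (s n) := fun n => Function.iterate_succ_apply' _ _ _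
  obtain ⟨ρ, hρ0, hρ, hρz⟩ := Segment.exists_path (u := fun n => (s n).1.1)
    (z := fun n => x (s n)) (m := fun n => a (s n)) (fun j => by rw [hs]; exact ha (s j))
  obtain ⟨σ, hσ0, hσ, hσz⟩ := Segment.exists_path (u := fun n => (s n).1.2)
    (z := fun n => x (s n)) (m := fun n => b (s n)) (fun j => by rw [hs]; exact hb (s j))
  -- Segments of positions concatenate to the identity walk on `ℕ`, so `hρz` speaks of the original
  -- walk.
  have hid : ∀ n, ρ n = n := fun n => by
    induction n with
    | zero => exact hρ0
    | succ n ih => rw [hρ, ih]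
  simp only [hid] at hρz
  exact ⟨σ, hσ0, hσ, (Quot.sound hρz).symm.trans (Quot.sound hσz)⟩

theorem finite_range_profile [Finite I] [Finite C] {r : C → ℕ} (hr : IsRank E lab c r)
    (g : V → I → V) : (Set.range (profile E lab c g)).Finite := by
  obtain ⟨R, hR⟩ := (Set.finite_range r).bddAbove
  have hfin : {p : List C × Option I | p.1.length ≤ R + 1}.Finite :=
    ((List.finite_length_le C (R + 1)).prod (Set.finite_univ (α := Option I))).subset
      fun p hp => ⟨hp, trivial⟩
  have hch : ∀ u l e, Chain E lab c u l e → l.length ≤ R + 1 := fun u l e h =>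
    (h.length_le hr).trans (Nat.succ_le_succ (hR ⟨_, rfl⟩))
  refine ((Set.finite_univ (α := Option I)).prod (hfin.finite_subsets.prod
    ((Set.finite_univ (α := I → C)).prod ((Set.finite_univ (α := Set (I × I))).prod
      (Set.Finite.pi' fun _ : I => hfin.finite_subsets))))).subset ?_
  rintro _ ⟨u, rfl⟩
  refine ⟨trivial, fun p hp => hch _ _ _ hp, trivial, trivial, fun i p hp => ?_⟩
  obtain ⟨w, -, hw⟩ := hp
  exact hch _ _ _ hw

theorem finite_range_words [Finite I] [Finite C] {g : V → I → V} (hg : IsMarking E lab g)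
    {r : C → ℕ} (hr : IsRank E lab c r) (hlab : ∀ u w, c u = c w → lab u = lab w) :
    (Set.range (words E c)).Finite := by
  have := (finite_range_profile hr g).to_subtype
  refine Set.Finite.of_surjOn (s := Set.univ)
    (fun p : Set.range (profile E lab c g) => words E c p.2.choose) ?_ Set.finite_univ
  rintro _ ⟨u, rfl⟩
  have h := (⟨profile E lab c g u, u, rfl⟩ : Set.range (profile E lab c g)).2.choose_spec
  exact ⟨⟨_, u, rfl⟩, trivial, (words_subset_of_profile_eq hg hr hlab h).antisymm
    (words_subset_of_profile_eq hg hr hlab h.symm)⟩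

theorem exists_isRank_words [Finite C] (hfin : (Set.range (words E c)).Finite) {r : C → ℕ}
    (hr : IsRank E lab c r) :
    ∃ r' : C × Set.range (words E c) → ℕ,
      IsRank E lab (fun u => (c u, ⟨words E c u, u, rfl⟩)) r' := by
  have := hfin.to_subtype
  let K := Nat.card (Set.range (words E c))
  -- Lexicographic rank: old rank first, then the number of word sets strictly below. That number is
  -- at most `K`, hence the factor `K + 1`.
  refine ⟨fun p => r p.1 * (K + 1) + {t : Set.range (words E c) | t < p.2}.ncard, ?_⟩
  intro u w hu hw he
  by_cases hc : c w = c u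
  · have hsub := words_subset_of_edge he hc
    by_cases heq : words E c w = words E c u
    · exact Or.inl (by simp only [hc, heq])
    · right
      simp only [hc]
      have hlt : (⟨words E c w, w, rfl⟩ : Set.range (words E c)) < ⟨words E c u, u, rfl⟩ :=
        lt_of_le_of_ne hsub fun h => heq (congrArg Subtype.val h)
      have hss : {t : Set.range (words E c) | t < ⟨words E c w, w, rfl⟩} ⊂
          {t : Set.range (words E c) | t < ⟨words E c u, u, rfl⟩} :=
        ⟨fun t ht => lt_trans ht hlt, fun h => lt_irrefl _ (Set.mem_ofPred_eq.mp (h hlt))⟩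
      exact Nat.add_lt_add_left (Set.ncard_lt_ncard hss (Set.toFinite _)) _
  · right
    have hlt := (hr u w hu hw he).resolve_left hc
    have hle : {t : Set.range (words E c) | t < ⟨words E c w, w, rfl⟩}.ncard ≤ K :=
      (Set.ncard_le_card _)
    have := Nat.mul_le_mul_right (K + 1) (Nat.succ_le_of_lt hlt)
    simp only [Nat.succ_mul] at this
    dsimp only
    omega

end Graph

-- Colors and formulas

section Logic

variable {k : ℕ}

/-- A topology together with a tuple of distinct vertices. -/
abbrev MarkedTopology (k : ℕ) : Type := Σ G : Topology, Fin k ↪ Fin G.n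

/-- The states of all graph LTSs. -/
abbrev Point (k : ℕ) : Type := Σ a : MarkedTopology k, Fin a.1.n

/-- The graph LTS of a marked topology. -/
abbrev MarkedTopology.lts (a : MarkedTopology k) : LTS (Fin k) := a.1.graphLTS a.2

/-- The disjoint union of the edge relations of all topologies. -/
inductive Point.Edge : Point k → Point k → Prop
  | mk (a : MarkedTopology k) (v w : Fin a.1.n) : (v, w) ∈ a.1.edge → Point.Edge ⟨a, v⟩ ⟨a, w⟩

open Classical in
/-- The index of a vertex in the tuple. -/
noncomputable def Point.lab (u : Point k) : Option (Fin k) :=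
  if h : ∃ i, u.1.2 i = u.2 then some h.choose else none

theorem Point.lab_eq_some {u : Point k} {i : Fin k} : u.lab = some i ↔ u.1.2 i = u.2 := by
  unfold Point.lab
  split_ifs with h
  · rw [Option.some.injEq]
    constructor
    · rintro rfl
      exact h.choose_spec
    · exact fun hi => u.1.2.injective (h.choose_spec.trans hi.symm)
  · simp only [false_iff]
    exact fun hi => h ⟨i, hi⟩

/-- The vertex with a given index. -/
def Point.mark (u : Point k) (i : Fin k) : Point k := ⟨u.1, u.1.2 i⟩

theorem Point.isMarking : IsMarking (Point.Edge (k := k)) Point.lab Point.mark where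
  edge := by
    rintro _ _ ⟨a, v, w, h⟩
    rfl
  eq := by
    rintro ⟨a, v⟩ i h
    rw [Point.lab_eq_some] at h
    simp only [Point.mark, h]
  lab := fun u i => by
    rw [Point.lab_eq_some]
    rfl

theorem Point.edge_iff {a : MarkedTopology k} {v w : Fin a.1.n} :
    Point.Edge ⟨a, v⟩ ⟨a, w⟩ ↔ (v, w) ∈ a.1.edge := by
  constructor
  · intro h
    cases h
    assumption
  · exact Point.Edge.mk a v w

theorem MarkedTopology.isPath_iff {a : MarkedTopology k} {π : ℕ → Fin a.1.n} :
    a.lts.IsPath π ↔ ∀ n, Point.Edge ⟨a, π n⟩ ⟨a, π (n + 1)⟩ := by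
  simp only [Point.edge_iff]
  exact ⟨fun h n => (h n).elim fun _ h => h, fun h n => ⟨(), h n⟩⟩

theorem Point.exists_path_eq {a : MarkedTopology k} {v : Fin a.1.n} {π : ℕ → Point k}
    (h0 : π 0 = ⟨a, v⟩) (hπ : ∀ n, Point.Edge (π n) (π (n + 1))) :
    ∃ ρ : ℕ → Fin a.1.n, ∀ n, π n = ⟨a, ρ n⟩ := by
  have : ∀ n, ∃ x, π n = ⟨a, x⟩ := fun n => by
    induction n with
    | zero => exact ⟨v, h0⟩
    | succ n ih =>
      obtain ⟨x, hx⟩ := ih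
      have := hπ n
      rw [hx] at this
      generalize π (n + 1) = p at this
      cases this
      exact ⟨_, rfl⟩
  choose ρ hρ using this
  exact ⟨ρ, hρ⟩

variable {C : Type} {c : Point k → C} {d : ℕ}

/-- The color `c` determines the truth of all state formulas of depth at most `d`. -/
def Determines (c : Point k → C) (d : ℕ) : Prop :=
  ∀ u v, c u = c v → ∀ φ : StateFormula (Fin k), φ.depth ≤ d →
    (φ.Sat u.1.lts u.2 ↔ φ.Sat v.1.lts v.2)

theorem PathFormula.sat_until {AP : Type} {M : LTS AP} {ψ ψ' : PathFormula AP} {π : ℕ → M.State} :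
    (PathFormula.until ψ ψ').Sat M π ↔ ∃ j, ψ'.Sat M (fun n => π (j + n)) ∧
      ∀ i < j, ψ.Sat M (fun n => π (i + n)) := by
  rw [PathFormula.Sat]

theorem PathFormula.sat_and {AP : Type} {M : LTS AP} {ψ ψ' : PathFormula AP} {π : ℕ → M.State} :
    (PathFormula.and ψ ψ').Sat M π ↔ ψ.Sat M π ∧ ψ'.Sat M π := by
  rw [PathFormula.Sat]

theorem PathFormula.sat_neg {AP : Type} {M : LTS AP} {ψ : PathFormula AP} {π : ℕ → M.State} :
    (PathFormula.neg ψ).Sat M π ↔ ¬ ψ.Sat M π := by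
  rw [PathFormula.Sat]

theorem PathFormula.sat_state {AP : Type} {M : LTS AP} {φ : StateFormula AP} {π : ℕ → M.State} :
    (PathFormula.state φ).Sat M π ↔ φ.Sat M (π 0) := by
  rw [PathFormula.Sat]

theorem StateFormula.sat_ex {AP : Type} {M : LTS AP} {ψ : PathFormula AP} {q : M.State} :
    (StateFormula.ex ψ).Sat M q ↔ ∃ π : ℕ → M.State, M.IsPath π ∧ π 0 = q ∧ ψ.Sat M π := by
  rw [StateFormula.Sat]

theorem StateFormula.sat_atom {AP : Type} {M : LTS AP} {p : AP} {q : M.State} :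
    (StateFormula.atom p).Sat M q ↔ p ∈ M.label q := by
  rw [StateFormula.Sat]

theorem Point.sat_atom {u : Point k} {p : Fin k} :
    (StateFormula.atom p).Sat u.1.lts u.2 ↔ u.lab = some p := by
  rw [Point.lab_eq_some]
  refine StateFormula.sat_atom.trans (Finset.mem_filter.trans ?_)
  exact and_iff_right (Finset.mem_univ p)

/-- Structural induction on `ψ`: its state subformulas have depth at most `d`, so they are read off
colors, and every suffix of an inflated word inflates a suffix of the original. -/
theorem Determines.exists_word_predicate (hc : Determines c d) :
    ∀ ψ : PathFormula (Fin k), ψ.depth ≤ d → ∃ P : (ℕ → C) → Prop,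
      (∀ w w', Inflates w w' → (P w ↔ P w')) ∧
      ∀ (a : MarkedTopology k) (π : ℕ → Fin a.1.n), ψ.Sat a.lts π ↔ P fun n => c ⟨a, π n⟩
  | .state φ, hd => by
    refine ⟨fun w => ∃ u, c u = w 0 ∧ φ.Sat u.1.lts u.2, ?_, fun a π => ?_⟩
    · rintro w w' ⟨f, hf, h⟩
      have h0 : w' 0 = w 0 := by rw [h, hf.zero]
      exact exists_congr fun u => by rw [h0]
    · refine PathFormula.sat_state.trans ?_
      exact ⟨fun h => ⟨⟨a, π 0⟩, rfl, h⟩, fun ⟨u, hu, h⟩ =>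
        (hc _ _ hu φ (by simpa only [PathFormula.depth] using hd)).1 h⟩
  | .neg ψ, hd => by
    obtain ⟨P, hP, h⟩ := hc.exists_word_predicate ψ (by simpa only [PathFormula.depth] using hd)
    refine ⟨fun w => ¬ P w, fun w w' hw => not_congr (hP w w' hw), fun a π => ?_⟩
    exact PathFormula.sat_neg.trans (not_congr (h a π))
  | .and ψ ψ', hd => by
    rw [PathFormula.depth, max_le_iff] at hd
    obtain ⟨P, hP, h⟩ := hc.exists_word_predicate ψ hd.1
    obtain ⟨P', hP', h'⟩ := hc.exists_word_predicate ψ' hd.2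
    refine ⟨fun w => P w ∧ P' w, fun w w' hw => and_congr (hP w w' hw) (hP' w w' hw),
      fun a π => ?_⟩
    exact PathFormula.sat_and.trans (and_congr (h a π) (h' a π))
  | .until ψ ψ', hd => by
    rw [PathFormula.depth, max_le_iff] at hd
    obtain ⟨P, hP, h⟩ := hc.exists_word_predicate ψ hd.1
    obtain ⟨P', hP', h'⟩ := hc.exists_word_predicate ψ' hd.2
    refine ⟨fun w => ∃ j, P' (fun n => w (j + n)) ∧ ∀ i < j, P fun n => w (i + n), ?_,
      fun a π => ?_⟩
    · rintro w w' ⟨f, hf, hw⟩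
      have hshift : ∀ j, Inflates (fun n => w (f j + n)) fun n => w' (j + n) := fun j =>
        ⟨_, hf.shift j, fun n => by
          dsimp only
          rw [hw, Nat.add_sub_cancel' (hf.monotone (Nat.le_add_right j n))]⟩
      constructor
      · rintro ⟨j, hj, hi⟩
        classical
        -- The least preimage of `j` is needed: earlier positions then map strictly below `j`.
        have hex := hf.surj j
        have hfind : f (Nat.find hex) = j := Nat.find_spec hex
        refine ⟨Nat.find hex, (hP' _ _ (hshift _)).1 (by rwa [hfind]), fun i hlt => ?_⟩
        refine (hP _ _ (hshift i)).1 (hi _ ?_)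
        have h1 := hf.monotone hlt.le
        have h2 := Nat.find_min hex hlt
        omega
      · rintro ⟨j, hj, hi⟩
        refine ⟨f j, (hP' _ _ (hshift j)).2 hj, fun i hlt => ?_⟩
        obtain ⟨m, rfl⟩ := hf.surj i
        exact (hP _ _ (hshift m)).2 (hi m (lt_of_not_ge fun hle => hlt.not_ge (hf.monotone hle)))
    · exact PathFormula.sat_until.trans (exists_congr fun j =>
        and_congr (h' a _) (forall₂_congr fun i _ => h a _))

theorem Determines.succ (hc : Determines c d) (hlab : ∀ u w, c u = c w → u.lab = w.lab) :
    Determines (fun u => (c u, (⟨words Point.Edge c u, u, rfl⟩ :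
      Set.range (words Point.Edge c)))) (d + 1) := by
  have himp : ∀ (ψ : PathFormula (Fin k)), ψ.depth ≤ d → ∀ u v : Point k,
      words Point.Edge c u ⊆ words Point.Edge c v →
      (StateFormula.ex ψ).Sat u.1.lts u.2 → (StateFormula.ex ψ).Sat v.1.lts v.2 := by
    intro ψ hψ u v huv h
    replace h := StateFormula.sat_ex.1 h
    refine StateFormula.sat_ex.2 ?_
    obtain ⟨P, hP, hsat⟩ := hc.exists_word_predicate ψ hψ
    obtain ⟨π, hπ, h0, h⟩ := h
    obtain ⟨σ, hσ0, hσ, hq⟩ := huv ⟨fun n => ⟨u.1, π n⟩, by simp only [h0],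
      MarkedTopology.isPath_iff.1 hπ, rfl⟩
    obtain ⟨ρ, hρ⟩ := Point.exists_path_eq hσ0 hσ
    simp only [hρ] at hσ hq
    refine ⟨ρ, MarkedTopology.isPath_iff.2 hσ, ?_, (hsat _ _).2 ?_⟩
    · have := (hρ 0).symm.trans hσ0
      exact eq_of_heq (Sigma.mk.inj this).2
    · have := congrArg (Quot.lift P fun w w' hw => propext (hP w w' hw)) hq
      exact this.mp ((hsat _ _).1 h)
  intro u v huv
  have huv1 : c u = c v := congrArg Prod.fst huv
  have huv2 : words Point.Edge c u = words Point.Edge c v :=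
    congrArg (fun p => p.2.1) huv
  intro φ hφ
  -- Path formulas need no induction hypothesis, since `himp` settles the `ex` case.
  induction φ using StateFormula.rec (motive_2 := fun _ => True) with
  | tt => simp only [StateFormula.Sat]
  | atom p =>
    rw [Point.sat_atom, Point.sat_atom, hlab _ _ huv1]
  | neg φ ih =>
    rw [StateFormula.depth] at hφ
    simp only [StateFormula.Sat, ih hφ]
  | and φ φ' ih ih' =>
    rw [StateFormula.depth, max_le_iff] at hφ
    simp only [StateFormula.Sat, ih hφ.1, ih' hφ.2]
  | ex ψ _ =>
    rw [StateFormula.depth, Nat.succ_le_succ_iff] at hφ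
    exact ⟨himp ψ hφ u v huv2.subset, himp ψ hφ v u huv2.superset⟩
  | _ => trivial

theorem determines_lab : Determines (Point.lab (k := k)) 0 := by
  intro u v huv φ hφ
  induction φ using StateFormula.rec (motive_2 := fun _ => True) with
  | tt => simp only [StateFormula.Sat]
  | atom p =>
    rw [Point.sat_atom, Point.sat_atom, huv]
  | neg φ ih =>
    rw [StateFormula.depth] at hφ
    simp only [StateFormula.Sat, ih hφ]
  | and φ φ' ih ih' =>
    rw [StateFormula.depth, max_le_iff] at hφ
    simp only [StateFormula.Sat, ih hφ.1, ih' hφ.2]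
  | ex ψ _ => simp [StateFormula.depth] at hφ
  | _ => trivial

/-- The rank and the dependence of labels on colors are carried along because finiteness of the next
color set requires them. -/
theorem exists_finite_coloring (k d : ℕ) :
    ∃ (C : Type) (_ : Finite C) (c : Point k → C) (r : C → ℕ),
      IsRank Point.Edge Point.lab c r ∧ (∀ u w, c u = c w → u.lab = w.lab) ∧ Determines c d := by
  induction d with
  | zero =>
    exact ⟨Option (Fin k), inferInstance, Point.lab, fun _ => 0,
      fun u w hu hw _ => Or.inl (hw.trans hu.symm), fun _ _ h => h, determines_lab⟩
  | succ d ih =>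
    obtain ⟨C, _, c, r, hr, hlab, hc⟩ := ih
    have hfin := finite_range_words Point.isMarking hr hlab
    have := hfin.to_subtype
    obtain ⟨r', hr'⟩ := exists_isRank_words hfin hr
    exact ⟨_, inferInstance, _, r', hr', fun u w h => hlab u w (congrArg Prod.fst h),
      hc.succ hlab⟩

end Logic

end TokenPassing

open TokenPassing in
theorem mainTheorem3 (k d : ℕ) (hk : 0 < k) (hd : 0 < d) :
    {C : Set (TokenPassing.LTS (Fin k)) |
      ∃ (G : TokenPassing.Topology) (g : Fin k ↪ Fin G.n),
        C = (G.graphLTS g).equivClass d}.Finite := by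
  obtain ⟨C, _, c, -, -, -, hc⟩ := exists_finite_coloring k d
  let init : MarkedTopology k → Point k := fun a => ⟨a, a.1.init⟩
  have hmodels : ∀ (a : MarkedTopology k) φ, a.lts.Models φ ↔ φ.Sat a.lts a.1.init := fun a φ =>
    ⟨fun h => h _ rfl, fun h q hq => by rw [Set.mem_singleton_iff.1 hq]; exact h⟩
  have hclass : ∀ a b, c (init a) = c (init b) → a.lts.equivClass d = b.lts.equivClass d := by
    intro a b hab
    have key : ∀ φ : StateFormula (Fin k), φ.depth ≤ d → (a.lts.Models φ ↔ b.lts.Models φ) :=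
      fun φ hφ => by rw [hmodels, hmodels]; exact hc _ _ hab φ hφ
    ext N
    exact forall₂_congr fun φ hφ => by rw [key φ hφ]
  -- Send a color to the union of the classes of all graph LTSs whose initial vertex has it; by
  -- `hclass` these classes coincide.
  refine Set.Finite.of_surjOn (s := Set.range fun a => c (init a))
    (fun x => {N | ∃ a, c (init a) = x ∧ N ∈ a.lts.equivClass d}) ?_ (Set.toFinite _)
  rintro _ ⟨G, g, rfl⟩
  refine ⟨_, ⟨⟨G, g⟩, rfl⟩, Set.ext fun N => ?_⟩
  exact ⟨fun ⟨a, ha, hN⟩ => hclass a ⟨G, g⟩ ha ▸ hN, fun hN => ⟨⟨G, g⟩, rfl, hN⟩⟩
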